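/- A JB-algebra is a real (commutative, not necessarily unital) Jordan algebra $A$ with a complete norm satisfying $\|ab\|\le\|a\|\|b\|$, $\|a^2\|=\|a\|^2$ and $\|a^2\|\le\|a^2+b^2\|$ for all $a,b\in A$. Put $A_+=\{a^2:a\in A\}$, order $A$ by $a\le b\iff b-a\in A_+$, let $P(A)=\{p\in A:p^2=p\}$ be the set of projections, and let $U_ab=2a(ab)-a^2b$. Projections $p,q$ are orthogonal if $pq=0$. A JB-algebra $A$ is called an AJW-algebra if (1) every set of pairwise orthogonal projections has a least upper bound in the partially ordered set $P(A)$; and (2) every maximal associative subalgebra $A_o$ of $A$ is the least norm-closed subalgebra containing $A_o\cap P(A)$. For $S\subseteq A$ put ${}^\perp(S)_+=\{x\in A_+: U_ax=0\text{ for all }a\in S\}$. **Lemma 2.4.** Let $A$ be an AJW-algebra and let $I$ be a norm-closed ideal of $A$, i.e. a norm-closed linear subspace with $ax\in I$ for all $a\in A$, $x\in I$. Then there exists a central projection $g\in A$ (that is, $g^2=g$ and $g(ab)=(ga)b$ for all $a,b\in A$) such that $${}^\perp\bigl({}^\perp(I)_+\bigr)_+=gA_+=\{ga:a\in A_+\}.$$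 -/

import Mathlib

/-- A JB-algebra: a real (commutative, not necessarily unital) Jordan algebra with a complete
norm such that `‖ab‖ ≤ ‖a‖‖b‖`, `‖a²‖ = ‖a‖²` and `‖a²‖ ≤ ‖a² + b²‖`. -/
class JBAlgebra (A : Type*) extends NormedAddCommGroup A, NonUnitalNonAssocCommRing A,
    NormedSpace ℝ A, IsCommJordan A, CompleteSpace A where
  /-- With commutativity of the product, this makes the product bilinear over `ℝ`. -/
  smul_mul : ∀ (r : ℝ) (a b : A), (r • a) * b = r • (a * b)
  norm_mul_le' : ∀ a b : A, ‖a * b‖ ≤ ‖a‖ * ‖b‖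
  norm_sq : ∀ a : A, ‖a * a‖ = ‖a‖ ^ 2
  norm_sq_le : ∀ a b : A, ‖a * a‖ ≤ ‖a * a + b * b‖

namespace JBAlgebra

/-- The operator `U_a b = {aba} = 2a(ab) - a²b`. -/
def U {A : Type*} [JBAlgebra A] (a b : A) : A :=
  (2 : ℝ) • (a * (a * b)) - (a * a) * b

/-- The positive cone `A₊` of a JB-algebra: the set of squares. -/
def posCone (A : Type*) [JBAlgebra A] : Set A := {x | ∃ a : A, x = a * a}

/-- The set `P(A)` of projections. -/
def projections (A : Type*) [JBAlgebra A] : Set A := {p | IsIdempotentElem p}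

/-- The order of a JB-algebra, `a ≤ b` iff `b - a ∈ A₊`. -/
def Le {A : Type*} [JBAlgebra A] (a b : A) : Prop := b - a ∈ posCone A

/-- `p` is the least upper bound of `S` in the partially ordered set `P(A)`. -/
def IsProjectionLUB {A : Type*} [JBAlgebra A] (S : Set A) (p : A) : Prop :=
  p ∈ projections A ∧ (∀ e ∈ S, Le e p) ∧
    ∀ q ∈ projections A, (∀ e ∈ S, Le e q) → Le p q

/-- The product is associative on the subalgebra `B`. -/
def IsAssociative {A : Type*} [JBAlgebra A] (B : NonUnitalSubalgebra ℝ A) : Prop :=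
  ∀ x ∈ B, ∀ y ∈ B, ∀ z ∈ B, (x * y) * z = x * (y * z)

/-- `⊥(S)₊ = {x ∈ A₊ : U_a x = 0 for all a ∈ S}`. -/
def annPos {A : Type*} [JBAlgebra A] (S : Set A) : Set A :=
  {x | x ∈ posCone A ∧ ∀ a ∈ S, U a x = 0}

/-- `I` is a (Jordan) ideal: a linear subspace with `ax ∈ I` for `a ∈ A`, `x ∈ I`. -/
def IsIdeal {A : Type*} [JBAlgebra A] (I : Submodule ℝ A) : Prop :=
  ∀ a : A, ∀ x ∈ I, a * x ∈ I

end JBAlgebra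

/-- An AJW-algebra: a JB-algebra in which every set of pairwise orthogonal projections has a
least upper bound in `P(A)`, and every maximal associative subalgebra is the least closed
subalgebra containing all its projections. -/
class IsAJWAlgebra (A : Type*) [JBAlgebra A] : Prop where
  exists_lub : ∀ S : Set A, S ⊆ JBAlgebra.projections A →
    S.Pairwise (fun p q => p * q = 0) → ∃ p : A, JBAlgebra.IsProjectionLUB S p
  generated : ∀ B : NonUnitalSubalgebra ℝ A, Maximal JBAlgebra.IsAssociative B →
    IsLeast {C : NonUnitalSubalgebra ℝ A |
      IsClosed (C : Set A) ∧ (B : Set A) ∩ JBAlgebra.projections A ⊆ C} B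

namespace JBAlgebra

section Jordan

variable {A : Type*} [JBAlgebra A]

/-! The projection `g` is the supremum of a maximal orthogonal family `S` of projections of `I`; it
need not lie in `I`. Every element of `A` lies in a maximal associative subalgebra, where it is a
norm limit of combinations of orthogonal projections, and this supplies spectral projections
(`exists_projection_near`).

If `x ∈ I` is nonzero and `gx = 0`, a spectral projection of `x` lies in `I` and enlarges `S`. So
`I` misses the Peirce space `A₀(g)`, and Peirce calculus puts `I` inside `A₁(g)`
(`exists_lub_unit_of_isIdeal`). The case `I = A` gives a unit `u`.

Suprema are normal: what is orthogonal to `S` is orthogonal to `g` (`IsProjectionLUB.mul_eq_zero`).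
This rests on `p ≤ e` implying `pe = p` (`mul_eq_of_le`). If `z ∈ A_{1/2}(g)` and `p ∈ S`, then `pz
∈ I ⊆ A₁(g)` forces `pz = 0`; hence `gz = 0` and `z = 0`, so `g` is central. Normality also
identifies the annihilator of `I` as the positive part of `A₀(g)`, and testing against `u - g` gives
the second annihilator. -/

instance : IsScalarTower ℝ A A := ⟨fun r a b => by simpa using smul_mul r a b⟩

instance : SMulCommClass ℝ A A :=
  ⟨fun r a b => by simp only [smul_eq_mul]; rw [mul_comm a (r • b), smul_mul, mul_comm b a]⟩

instance : ContinuousMul A := by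
  have h : IsBoundedBilinearMap ℝ (fun x : A × A => x.1 * x.2) :=
    { add_left := fun _ _ _ => add_mul _ _ _
      smul_left := fun _ _ _ => smul_mul_assoc _ _ _
      add_right := fun _ _ _ => mul_add _ _ _
      smul_right := fun _ _ _ => mul_smul_comm _ _ _
      bound := ⟨1, one_pos, fun x y => by simpa using norm_mul_le' x y⟩ }
  exact ⟨h.continuous⟩

/-! ### Jordan identities -/

/-- The fully linearised Jordan identity. -/
theorem jordan_linearized (a b c w : A) :
    a * ((b * c) * w) + b * ((c * a) * w) + c * ((a * b) * w) =
      (b * c) * (a * w) + (c * a) * (b * w) + (a * b) * (c * w) := by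
  have h : (2 : ℕ) • ((a * ((b * c) * w) - (b * c) * (a * w)) +
      (b * ((c * a) * w) - (c * a) * (b * w)) + (c * ((a * b) * w) - (a * b) * (c * w))) = 0 :=
    DFunLike.congr_fun (two_nsmul_lie_lmul_lmul_add_add_eq_zero a b c) w
  linear_combination (norm := module) (1 / 2 : ℝ) • h

theorem jordan_identity (a b : A) : (a * b) * (a * a) = a * (b * (a * a)) :=
  IsCommJordan.lmul_comm_rmul_rmul a b

theorem eq_zero_of_mul_self {a : A} (h : a * a = 0) : a = 0 := by
  have := norm_sq a
  rw [h, norm_zero] at this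
  exact norm_eq_zero.1 (pow_eq_zero_iff two_ne_zero |>.1 this.symm)

theorem eq_zero_of_cube {a : A} (h : a * (a * a) = 0) : a = 0 := by
  have h1 := jordan_identity a a
  rw [h, mul_zero] at h1
  exact eq_zero_of_mul_self (eq_zero_of_mul_self h1)

/-- The principal powers: `pow a n = aⁿ⁺¹`. -/
def pow (a : A) : ℕ → A
  | 0 => a
  | n + 1 => a * pow a n

/-- A linear map commuting with multiplication by `a` and by `a²` commutes with multiplication by
every power of `a`. -/
theorem map_pow_mul (a : A) (T : A →ₗ[ℝ] A) (h₁ : ∀ w, T (a * w) = a * T w)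
    (h₂ : ∀ w, T ((a * a) * w) = (a * a) * T w) (n : ℕ) :
    ∀ w, T (pow a n * w) = pow a n * T w := by
  suffices H : (∀ w, T (pow a n * w) = pow a n * T w) ∧
      ∀ w, T (pow a (n + 1) * w) = pow a (n + 1) * T w from H.1
  induction n with
  | zero => exact ⟨h₁, h₂⟩
  | succ n ih =>
    refine ⟨ih.2, fun w => ?_⟩
    -- This recursion exhibits multiplication by any power as a polynomial in the multiplications by
    -- `a` and `a²`.
    have key : ∀ w : A, pow a (n + 2) * w = (2 : ℝ) • (pow a (n + 1) * (a * w)) +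
        (a * a) * (pow a n * w) - a * (a * (pow a n * w)) - pow a n * (a * (a * w)) := by
      intro w
      have := jordan_linearized a w (pow a n) a
      rw [mul_comm (w * pow a n) a, mul_comm (a * w) a, mul_comm (pow a n * a) a,
        mul_comm w (pow a n), mul_comm (pow a n) a, mul_comm w a, mul_comm (pow a n * w),
        mul_comm (a * w) (a * pow a n), mul_comm w] at this
      change _ + pow a (n + 2) * w + _ = _ + pow a (n + 1) * _ + pow a (n + 1) * _ at this
      linear_combination (norm := module) this
    rw [key, key]
    simp only [map_sub, map_add, map_smul, h₁, h₂, ih.1, ih.2]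

theorem mul_sq_mul (a w : A) : a * ((a * a) * w) = (a * a) * (a * w) := by
  rw [mul_comm _ w, ← jordan_identity, mul_comm]

theorem mul_pow_mul (a : A) (n : ℕ) (w : A) : a * (pow a n * w) = pow a n * (a * w) :=
  map_pow_mul a (LinearMap.mulLeft ℝ a) (fun _ => rfl) (mul_sq_mul a) n w

theorem pow_mul_pow_mul (a : A) (m n : ℕ) (w : A) :
    pow a m * (pow a n * w) = pow a n * (pow a m * w) :=
  map_pow_mul a (LinearMap.mulLeft ℝ (pow a m)) (fun w => (mul_pow_mul a m w).symm)
    (fun w => (map_pow_mul a (LinearMap.mulLeft ℝ (a * a)) (fun w => (mul_sq_mul a w).symm)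
      (fun _ => rfl) m w).symm) n w

theorem pow_mul_pow (a : A) (m n : ℕ) : pow a m * pow a n = pow a (m + n + 1) := by
  induction n with
  | zero => rw [pow, mul_comm]; rfl
  | succ n ih => rw [pow, ← mul_pow_mul, ih]; rfl

/-- The span of the powers of `a`, a subalgebra. -/
def powSpan (a : A) : NonUnitalSubalgebra ℝ A where
  toSubmodule := Submodule.span ℝ (Set.range (pow a))
  mul_mem' := by
    intro x y hx hy
    change x ∈ Submodule.span ℝ (Set.range (pow a)) at hx
    change y ∈ Submodule.span ℝ (Set.range (pow a)) at hy
    change x * y ∈ Submodule.span ℝ (Set.range (pow a))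
    induction hx, hy using Submodule.span_induction₂ with
    | mem_mem x y hx hy =>
      obtain ⟨m, rfl⟩ := hx
      obtain ⟨n, rfl⟩ := hy
      exact Submodule.subset_span ⟨_, (pow_mul_pow a m n).symm⟩
    | zero_left y hy => simp
    | zero_right x hx => simp
    | add_left x y z _ _ _ h₁ h₂ => rw [add_mul]; exact add_mem h₁ h₂
    | add_right x y z _ _ _ h₁ h₂ => rw [mul_add]; exact add_mem h₁ h₂
    | smul_left r x y _ _ h => rw [smul_mul_assoc]; exact Submodule.smul_mem _ _ h
    | smul_right r x y _ _ h => rw [mul_smul_comm]; exact Submodule.smul_mem _ _ h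

theorem self_mem_powSpan (a : A) : a ∈ powSpan a := Submodule.subset_span ⟨0, rfl⟩

theorem mul_mul_comm_of_mem_powSpan {a x y : A} (hx : x ∈ powSpan a) (hy : y ∈ powSpan a) (w : A) :
    x * (y * w) = y * (x * w) := by
  change x ∈ Submodule.span ℝ (Set.range (pow a)) at hx
  change y ∈ Submodule.span ℝ (Set.range (pow a)) at hy
  induction hx, hy using Submodule.span_induction₂ with
  | mem_mem x y hx hy =>
    obtain ⟨m, rfl⟩ := hx
    obtain ⟨n, rfl⟩ := hy
    exact pow_mul_pow_mul a m n w
  | zero_left y hy => simp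
  | zero_right x hx => simp
  | add_left x y z _ _ _ h₁ h₂ => simp only [add_mul, mul_add, h₁, h₂]
  | add_right x y z _ _ _ h₁ h₂ => simp only [add_mul, mul_add, h₁, h₂]
  | smul_left r x y _ _ h => simp only [smul_mul_assoc, mul_smul_comm, h]
  | smul_right r x y _ _ h => simp only [smul_mul_assoc, mul_smul_comm, h]

/-- Jordan algebras are power associative. -/
theorem isAssociative_powSpan (a : A) : IsAssociative (powSpan a) := by
  intro x hx y hy z hz
  rw [mul_comm, mul_mul_comm_of_mem_powSpan hz hx, mul_comm z]

/-- Every element lies in a maximal associative subalgebra. -/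
theorem exists_maximal_isAssociative (a : A) :
    ∃ B : NonUnitalSubalgebra ℝ A, a ∈ B ∧ Maximal IsAssociative B := by
  obtain ⟨B, hB, hm⟩ := zorn_le_nonempty₀ {B : NonUnitalSubalgebra ℝ A | IsAssociative B}
    (fun c hc hchain C₀ hC₀ => by
      have hdir : DirectedOn (· ≤ ·) c := hchain.directedOn
      refine ⟨sSup c, ?_, fun C hC => le_sSup hC⟩
      have mem : ∀ x, x ∈ sSup c ↔ ∃ C ∈ c, x ∈ C := by
        intro x
        have : Nonempty c := ⟨⟨C₀, hC₀⟩⟩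
        rw [sSup_eq_iSup', ← SetLike.mem_coe,
          NonUnitalSubalgebra.coe_iSup_of_directed hdir.directed_val]
        simp
      intro x hx y hy z hz
      obtain ⟨C₁, h₁, hx⟩ := (mem x).1 hx
      obtain ⟨C₂, h₂, hy⟩ := (mem y).1 hy
      obtain ⟨C₃, h₃, hz⟩ := (mem z).1 hz
      obtain ⟨C₄, h₄, h14, h24⟩ := hdir C₁ h₁ C₂ h₂
      obtain ⟨C, hC, h4, h3⟩ := hdir C₄ h₄ C₃ h₃
      exact hc hC x (h4 (h14 hx)) y (h4 (h24 hy)) z (h3 hz))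
    (powSpan a) (isAssociative_powSpan a)
  exact ⟨B, hB (self_mem_powSpan a), hm⟩

/-! ### Peirce decomposition -/

/-- Multiplication by `q` is a root of `t(2t - 1)(t - 1)`, whence the Peirce spaces for `0`, `1/2`
and `1`. -/
theorem peirce_cubic {q : A} (hq : q * q = q) (x : A) :
    (2 : ℝ) • (q * (q * (q * x))) + q * x = (3 : ℝ) • (q * (q * x)) := by
  have h := jordan_linearized q q x q
  rw [hq, hq, mul_comm x q, mul_comm (q * x) q] at h
  linear_combination (norm := module) h

theorem mul_comm_of_peirce_zero {q c : A} (hc : q * c = 0) (hq : q * q = q) (w : A) :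
    q * (c * w) = c * (q * w) := by
  have h := jordan_linearized q q c w
  rw [mul_comm c q, hc, hq] at h
  simpa using h.symm

theorem mul_comm_of_peirce_one {q c : A} (hc : q * c = c) (hq : q * q = q) (w : A) :
    q * (c * w) = c * (q * w) := by
  have h := jordan_linearized q q c w
  rw [mul_comm c q, hc, hq] at h
  linear_combination (norm := module) h

/-- Both `b` and `c` operator commute with `q`, so `q(bc)` equals `b(qc) = 0` and also `c(qb) = cb`.
-/
theorem mul_eq_zero_of_peirce {q b c : A} (hq : q * q = q) (hb : q * b = b) (hc : q * c = 0) :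
    b * c = 0 := by
  have h₁ := mul_comm_of_peirce_one hb hq c
  have h₂ := mul_comm_of_peirce_zero hc hq b
  rw [hc, mul_zero] at h₁
  rwa [mul_comm c b, h₁, hb, mul_comm, eq_comm] at h₂

/-- `A_{1/2} A_{1/2} ⊆ A_1 + A_0`. -/
theorem peirce_half_mul_half {q b c : A} (hq : q * q = q) (hb : q * b = (1 / 2 : ℝ) • b)
    (hc : q * c = (1 / 2 : ℝ) • c) : q * (q * (b * c)) = q * (b * c) := by
  have h := jordan_linearized q b c q
  rw [mul_comm c q, hb, hc, mul_comm _ q] at h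
  simp only [smul_mul_assoc, mul_smul_comm, hq, mul_comm _ q, hb, hc] at h
  rw [mul_comm c b] at h
  linear_combination (norm := module) h

theorem eq_zero_of_peirce_half_of_mul_sq_eq_zero {q z : A} (hz : q * z = (1 / 2 : ℝ) • z)
    (h : q * (z * z) = 0) : z = 0 := by
  have h₁ := jordan_identity z q
  rw [h, mul_zero, mul_comm z q, hz, smul_mul_assoc] at h₁
  exact eq_zero_of_cube ((smul_eq_zero_iff_right (by norm_num)).1 h₁)

theorem eq_zero_of_peirce_half_of_mul_sq_eq_self {q z : A} (hz : q * z = (1 / 2 : ℝ) • z)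
    (h : q * (z * z) = z * z) : z = 0 := by
  have h₁ := jordan_identity z q
  rw [h, mul_comm z q, hz, smul_mul_assoc] at h₁
  refine eq_zero_of_cube ?_
  linear_combination (norm := module) (-2 : ℝ) • h₁

/-- `U_z` maps into `A_0(p)` if `z ∈ A_0(p)`. -/
theorem mul_U_eq_zero {p z : A} (hp : p * p = p) (hz : p * z = 0) (w : A) : p * U z w = 0 := by
  have hz₂ : p * (z * z) = 0 := by rw [mul_comm_of_peirce_zero hz hp, hz, mul_zero]
  -- After commuting `p` past `z`, this reads `2z(z(pw)) = z²(pw)`, that is `U_z(pw) = 0`, while `p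
  -- U_z w = U_z(pw)`.
  have h := jordan_linearized z p w z
  rw [mul_comm z p, hz, mul_comm (p * w) z, mul_comm (w * z) z, mul_comm w z] at h
  simp only [zero_mul, mul_zero, add_zero, mul_comm_of_peirce_zero hz hp] at h
  rw [mul_comm (p * w)] at h
  rw [U, mul_sub, mul_smul_comm, mul_comm_of_peirce_zero hz hp, mul_comm_of_peirce_zero hz hp,
    mul_comm_of_peirce_zero hz₂ hp, ← h]
  module

theorem U_eq_zero_of_peirce {q b c : A} (hq : q * q = q) (hb : q * b = b) (hc : q * c = 0) :
    U b c = 0 := by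
  have hb₂ : q * (b * b) = b * b := by rw [mul_comm_of_peirce_one hb hq, hb]
  simp [U, mul_eq_zero_of_peirce hq hb hc, mul_eq_zero_of_peirce hq hb₂ hc]

theorem U_eq_zero_of_peirce' {q b c : A} (hq : q * q = q) (hb : q * b = 0) (hc : q * c = c) :
    U b c = 0 := by
  have hb₂ : q * (b * b) = 0 := by rw [mul_comm_of_peirce_zero hb hq, hb, mul_zero]
  simp [U, mul_comm _ c, mul_eq_zero_of_peirce hq hc hb, mul_eq_zero_of_peirce hq hc hb₂]

/-- A projection without half Peirce space is central. -/
theorem mem_center_of_mul_mul {g : A} (h : ∀ x, g * (g * x) = g * x) (hg : g * g = g) :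
    g ∈ Set.center A := by
  have left : ∀ b c : A, g * (b * c) = (g * b) * c := by
    intro b c
    have h₁ := mul_comm_of_peirce_one (h b) hg c
    have h0 : g * (b - g * b) = 0 := by rw [mul_sub, h, sub_self]
    have h₂ := mul_comm_of_peirce_zero h0 hg c
    have h₃ := mul_eq_zero_of_peirce hg (h c) h0
    have h₄ : g * (c - g * c) = 0 := by rw [mul_sub, h, sub_self]
    have h₅ := mul_eq_zero_of_peirce hg (h b) h₄
    rw [mul_comm (g * c)] at h₃
    rw [h₃] at h₂
    rw [mul_sub, sub_eq_zero] at h₅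
    rw [sub_mul, mul_sub, h₁, ← h₅, sub_eq_zero] at h₂
    exact h₂
  refine ⟨fun a => mul_comm g a, left, fun a b => ?_⟩
  rw [mul_comm, mul_comm a b, left, mul_comm a, mul_comm b]

end Jordan

section Spectral

variable {A : Type*} [JBAlgebra A]

/-! ### Finite families of orthogonal projections -/

/-- A family of pairwise orthogonal projections. -/
structure IsOrthogonalFamily {ι : Type*} (e : ι → A) : Prop where
  idem : ∀ i, e i * e i = e i
  orth : ∀ i j, i ≠ j → e i * e j = 0

theorem norm_le_one_of_idem {p : A} (hp : p * p = p) : ‖p‖ ≤ 1 := by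
  have h := norm_sq p
  rw [hp] at h
  nlinarith [norm_nonneg p]

theorem eq_zero_of_idem_of_norm_lt_one {p : A} (hp : p * p = p) (h1 : ‖p‖ < 1) : p = 0 := by
  have h := norm_sq p
  rw [hp] at h
  refine norm_eq_zero.1 ?_
  nlinarith [norm_nonneg p]

namespace IsOrthogonalFamily

variable {ι : Type*} [Fintype ι] {e : ι → A}

theorem sum_mul_sum (he : IsOrthogonalFamily e) (f g : ι → ℝ) :
    (∑ i, f i • e i) * (∑ i, g i • e i) = ∑ i, (f i * g i) • e i := by
  classical
  rw [Finset.sum_mul_sum]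
  refine Finset.sum_congr rfl fun i _ => ?_
  rw [Finset.sum_eq_single i]
  · rw [smul_mul_smul_comm, he.idem]
  · intro j _ hj
    rw [smul_mul_smul_comm, he.orth i j hj.symm, smul_zero]
  · simp

theorem norm_pow_two_pow (he : IsOrthogonalFamily e) (f : ι → ℝ) (n : ℕ) :
    ‖∑ i, f i • e i‖ ^ 2 ^ n = ‖∑ i, (f i ^ 2 ^ n) • e i‖ := by
  induction n with
  | zero => simp
  | succ n ih =>
    rw [_root_.pow_succ, _root_.pow_mul, ih, ← norm_sq, he.sum_mul_sum]
    simp_rw [← _root_.pow_add, ← mul_two]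

/-- By `‖a²‖ = ‖a‖²`, the `2ⁿ`-th power of the norm grows at most like `card ι * N ^ 2 ^ n` for each
`N > M`; letting `n` grow removes the factor `card ι`. -/
theorem norm_sum_le (he : IsOrthogonalFamily e) {f : ι → ℝ} {M : ℝ} (hM : 0 ≤ M)
    (hf : ∀ i, |f i| ≤ M) : ‖∑ i, f i • e i‖ ≤ M := by
  refine le_of_forall_gt_imp_ge_of_dense fun N hN => ?_
  have hN0 : 0 < N := hM.trans_lt hN
  by_contra! hlt
  have h1 : 1 < ‖∑ i, f i • e i‖ / N := (one_lt_div hN0).2 hlt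
  obtain ⟨n, hn⟩ := pow_unbounded_of_one_lt (Fintype.card ι : ℝ) h1
  have h2 : (Fintype.card ι : ℝ) < (‖∑ i, f i • e i‖ / N) ^ 2 ^ n :=
    hn.trans_le (pow_le_pow_right₀ h1.le n.lt_two_pow_self.le)
  rw [div_pow, lt_div_iff₀ (by positivity), he.norm_pow_two_pow] at h2
  refine absurd h2 (not_lt.2 ?_)
  calc ‖∑ i, (f i ^ 2 ^ n) • e i‖ ≤ ∑ i, ‖(f i ^ 2 ^ n) • e i‖ := _root_.norm_sum_le _ _
    _ ≤ ∑ _i : ι, N ^ 2 ^ n := by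
        refine Finset.sum_le_sum fun i _ => ?_
        rw [norm_smul, norm_pow, Real.norm_eq_abs]
        calc |f i| ^ 2 ^ n * ‖e i‖ ≤ |f i| ^ 2 ^ n * 1 := by
              gcongr; exact norm_le_one_of_idem (he.idem i)
          _ ≤ N ^ 2 ^ n := by
              rw [mul_one]; gcongr; exact (hf i).trans hN.le
    _ = Fintype.card ι * N ^ 2 ^ n := by simp

theorem abs_le_norm_sum (he : IsOrthogonalFamily e) (f : ι → ℝ) {i : ι} (hi : e i ≠ 0) :
    |f i| ≤ ‖∑ j, f j • e j‖ := by
  classical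
  have h1 : (1 : ℝ) ≤ ‖e i‖ := by
    by_contra! h
    exact hi (eq_zero_of_idem_of_norm_lt_one (he.idem i) h)
  have h2 : (∑ j, f j • e j) * e i = f i • e i := by
    have := he.sum_mul_sum f (Pi.single i 1)
    simpa [Pi.single_apply, ite_smul] using this
  have h3 := norm_mul_le' (∑ j, f j • e j) (e i)
  rw [h2, norm_smul, Real.norm_eq_abs] at h3
  exact le_of_mul_le_mul_right h3 (by linarith)

end IsOrthogonalFamily

/-! ### Spectral sums and approximate spectral projections -/

/-- `x` is a finite real combination of pairwise orthogonal projections from `B`. -/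
def IsSpectralSum (B : NonUnitalSubalgebra ℝ A) (x : A) : Prop :=
  ∃ (ι : Type) (_ : Fintype ι) (e : ι → A) (f : ι → ℝ),
    IsOrthogonalFamily e ∧ (∀ i, e i ∈ B) ∧ x = ∑ i, f i • e i

/-- With `s = ∑ eᵢ`, the projection `q` refines the family to `eᵢq`, `eᵢ - eᵢq` and `q - sq`, with
coefficients `fᵢ + r`, `fᵢ` and `r`. -/
theorem IsSpectralSum.add_smul {B : NonUnitalSubalgebra ℝ A} (hB : IsAssociative B) {x : A}
    (hx : IsSpectralSum B x) {q : A} (hq : q * q = q) (hqB : q ∈ B) (r : ℝ) :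
    IsSpectralSum B (x + r • q) := by
  obtain ⟨ι, _, e, f, he, heB, rfl⟩ := hx
  set s := ∑ i, e i with hs
  have hsB : s ∈ B := sum_mem fun i _ => heB i
  have hes : ∀ i, e i * s = e i := by
    classical
    intro i
    rw [hs, Finset.mul_sum, Finset.sum_eq_single i, he.idem]
    · exact fun j _ hj => he.orth i j hj.symm
    · simp
  have hprod : ∀ i j, (e i * q) * (e j * q) = (e i * e j) * q := by
    intro i j
    rw [hB _ (heB i) _ hqB _ (B.mul_mem (heB j) hqB), mul_comm (e j) q,
      ← hB _ hqB _ hqB _ (heB j), hq, mul_comm q, ← hB _ (heB i) _ (heB j) _ hqB]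
  have hl : ∀ i j, e i * (e j * q) = (e i * e j) * q := fun i j =>
    (hB _ (heB i) _ (heB j) _ hqB).symm
  have hr : ∀ i j, (e i * q) * e j = (e i * e j) * q := fun i j => by
    rw [mul_comm, hl, mul_comm (e j)]
  have hsq : ∀ i, (e i * q) * (s * q) = e i * q := by
    intro i
    rw [hs, Finset.sum_mul, Finset.mul_sum]
    simp_rw [hprod]
    rw [← Finset.sum_mul, ← Finset.mul_sum, ← hs, hes]
  have hsq' : ∀ i, e i * (s * q) = e i * q := fun i => by
    rw [← hB _ (heB i) _ hsB _ hqB, hes]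
  have hqq : ∀ i, (e i * q) * q = e i * q := fun i => by
    rw [hB _ (heB i) _ hqB _ hqB, hq]
  have hsqq : (s * q) * q = s * q := by rw [hB _ hsB _ hqB _ hqB, hq]
  have hsqsq : (s * q) * (s * q) = s * q := by
    calc (s * q) * (s * q) = (∑ i, e i * q) * (s * q) := by rw [hs, Finset.sum_mul]
      _ = ∑ i, e i * q := by rw [Finset.sum_mul]; simp_rw [hsq]
      _ = s * q := by rw [hs, Finset.sum_mul]
  refine ⟨Option (ι ⊕ ι), inferInstance,
    fun k => k.elim (q - s * q) (Sum.elim (fun i => e i * q) (fun i => e i - e i * q)),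
    fun k => k.elim r (Sum.elim (fun i => f i + r) f), ⟨?_, ?_⟩, ?_, ?_⟩
  · rintro (_ | i | i)
    · simp only [Option.elim_none, mul_sub, sub_mul, hq, hsqq, mul_comm q, hsqsq]
      simp
    · simp [hprod, he.idem]
    · simp only [Option.elim_some, Sum.elim_inr, mul_sub, sub_mul, hl, hr, hprod, he.idem]
      simp
  · have hnone : ∀ i, (e i * q) * (q - s * q) = 0 := fun i => by
      rw [mul_sub, hqq, hsq, sub_self]
    have hnone' : ∀ i, e i * (q - s * q) = 0 := fun i => by
      rw [mul_sub, hsq', sub_self]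
    rintro (_ | i | i) (_ | j | j) hij
    · exact absurd rfl hij
    · simp [mul_comm _ (e j * q), hnone]
    · simp only [Option.elim_none, Option.elim_some, Sum.elim_inr, mul_sub (q - s * q),
        mul_comm (q - s * q), hnone, hnone', sub_zero]
    · simp [hnone]
    · have : i ≠ j := fun h => hij (by rw [h])
      simp [hprod, he.orth _ _ this]
    · simp [mul_sub, hr, hprod]
    · simp [sub_mul, hnone, hnone']
    · simp [sub_mul, hl, hprod]
    · have : i ≠ j := fun h => hij (by rw [h])
      simp [sub_mul, mul_sub, hl, hr, hprod, he.orth _ _ this]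
  · rintro (_ | i | i)
    · exact B.sub_mem hqB (B.mul_mem hsB hqB)
    · exact B.mul_mem (heB i) hqB
    · exact B.sub_mem (heB i) (B.mul_mem (heB i) hqB)
  · simp only [Fintype.sum_option, Fintype.sum_sum_type, Option.elim_none, Option.elim_some,
      Sum.elim_inl, Sum.elim_inr, smul_sub, Finset.sum_sub_distrib,
      _root_.add_smul, Finset.sum_add_distrib]
    rw [← Finset.smul_sum, ← Finset.sum_mul, ← hs]
    module

theorem isSpectralSum_of_mem_span {B : NonUnitalSubalgebra ℝ A} (hB : IsAssociative B) {x : A}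
    (hx : x ∈ Submodule.span ℝ ((B : Set A) ∩ projections A)) : IsSpectralSum B x := by
  obtain ⟨n, f, g, rfl⟩ := Submodule.mem_span_set'.1 hx
  induction (Finset.univ : Finset (Fin n)) using Finset.induction_on with
  | empty => exact ⟨Empty, inferInstance, Empty.elim, Empty.elim, ⟨nofun, nofun⟩, nofun, by simp⟩
  | insert i s hi ih =>
    rw [Finset.sum_insert hi, add_comm]
    exact ih.add_smul hB (g i).2.2 (g i).2.1 _

/-- The closed span of the projections of an associative subalgebra. -/
def closedProjectionSpan {B : NonUnitalSubalgebra ℝ A} (hB : IsAssociative B) :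
    NonUnitalSubalgebra ℝ A where
  toSubmodule := (Submodule.span ℝ ((B : Set A) ∩ projections A)).topologicalClosure
  mul_mem' := by
    intro x y hx hy
    refine map_mem_closure₂ continuous_mul hx hy fun x hx y hy => ?_
    change x ∈ Submodule.span ℝ ((B : Set A) ∩ projections A) at hx
    change y ∈ Submodule.span ℝ ((B : Set A) ∩ projections A) at hy
    change x * y ∈ Submodule.span ℝ ((B : Set A) ∩ projections A)
    induction hx, hy using Submodule.span_induction₂ with
    | mem_mem p q hp hq =>
      refine Submodule.subset_span ⟨B.mul_mem hp.1 hq.1, ?_⟩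
      change (p * q) * (p * q) = p * q
      rw [hB _ hp.1 _ hq.1 _ (B.mul_mem hp.1 hq.1), mul_comm p q, ← hB _ hq.1 _ hq.1 _ hp.1,
        hq.2.eq, mul_comm q p, ← hB _ hp.1 _ hp.1 _ hq.1, hp.2.eq]
    | zero_left y hy => simp
    | zero_right x hx => simp
    | add_left x y z _ _ _ h₁ h₂ => rw [add_mul]; exact add_mem h₁ h₂
    | add_right x y z _ _ _ h₁ h₂ => rw [mul_add]; exact add_mem h₁ h₂
    | smul_left r x y _ _ h => rw [smul_mul_assoc]; exact Submodule.smul_mem _ _ h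
    | smul_right r x y _ _ h => rw [mul_smul_comm]; exact Submodule.smul_mem _ _ h

variable [IsAJWAlgebra A]

/-- Elements of a maximal associative subalgebra are limits of spectral sums. -/
theorem exists_isSpectralSum_near {B : NonUnitalSubalgebra ℝ A} (hB : Maximal IsAssociative B)
    {x : A} (hx : x ∈ B) {ε : ℝ} (hε : 0 < ε) : ∃ s, IsSpectralSum B s ∧ ‖x - s‖ < ε := by
  have hle : B ≤ closedProjectionSpan hB.prop := (IsAJWAlgebra.generated B hB).2
    ⟨isClosed_closure, fun p hp => subset_closure (Submodule.subset_span hp)⟩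
  obtain ⟨s, hs, hd⟩ := Metric.mem_closure_iff.1 (hle hx) ε hε
  exact ⟨s, isSpectralSum_of_mem_span hB.prop hs, by rwa [← dist_eq_norm]⟩

/-- Approximate spectral projections. -/
theorem exists_projection_near {B : NonUnitalSubalgebra ℝ A} (hB : Maximal IsAssociative B)
    {x : A} (hx : x ∈ B) {ε : ℝ} (hε : 0 < ε) :
    ∃ f ∈ B, f * f = f ∧ f ∈ closure (Set.image (x * ·) B) ∧ ‖x - x * f‖ ≤ ε := by
  obtain ⟨_, ⟨ι, _, e, l, he, heB, rfl⟩, hs⟩ :=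
    exists_isSpectralSum_near hB hx (show 0 < ε / 4 by positivity)
  set s := ∑ i, l i • e i with hs_def
  classical
  -- Here `f` is the spectral projection of `s` for `|t| > ε/2`, and `u` inverts `s` there with `‖u‖
  -- ≤ 2/ε`; as `‖x - s‖ < ε/4`, this gives `‖f - xu‖ ≤ 1/2`.
  let χ : ι → ℝ := fun i => if ε / 2 < |l i| then 1 else 0
  set f := ∑ i, χ i • e i with hf_def
  set u := ∑ i, (χ i * (l i)⁻¹) • e i with hu_def
  have hfB : f ∈ B := sum_mem fun i _ => B.smul_mem _ (heB i)
  have huB : u ∈ B := sum_mem fun i _ => B.smul_mem _ (heB i)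
  have hff : f * f = f := by
    rw [hf_def, he.sum_mul_sum]
    refine Finset.sum_congr rfl fun i _ => ?_
    simp only [χ]; split_ifs <;> simp
  have hsu : s * u = f := by
    rw [hs_def, hu_def, hf_def, he.sum_mul_sum]
    refine Finset.sum_congr rfl fun i _ => ?_
    simp only [χ]
    split_ifs with h
    · have : l i ≠ 0 := by rintro h0; rw [h0, abs_zero] at h; linarith
      rw [one_mul, mul_inv_cancel₀ this]
    · simp
  have hu : ‖u‖ ≤ 2 / ε := by
    refine he.norm_sum_le (by positivity) fun i => ?_
    simp only [χ]
    split_ifs with h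
    · rw [one_mul, abs_inv, inv_le_comm₀ (by linarith) (by positivity), inv_div]
      exact h.le
    · simp; positivity
  have hsf : ‖s - s * f‖ ≤ ε / 2 := by
    rw [hs_def, hf_def, he.sum_mul_sum, ← Finset.sum_sub_distrib]
    simp_rw [← sub_smul]
    refine he.norm_sum_le (by positivity) fun i => ?_
    simp only [χ]
    split_ifs with h
    · simp; positivity
    · simpa using not_lt.1 h
  have hfu : ‖f - x * u‖ ≤ 1 / 2 := by
    rw [← hsu, ← sub_mul]
    calc ‖(s - x) * u‖ ≤ ‖s - x‖ * ‖u‖ := norm_mul_le' _ _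
      _ ≤ (ε / 4) * (2 / ε) := by
          gcongr; rw [norm_sub_rev]; exact hs.le
      _ = 1 / 2 := by field_simp; norm_num
  refine ⟨f, hfB, hff, ?_, ?_⟩
  -- Neumann series idea: powers of `f - xu` keep the form `f - xy` with `y ∈ B`, and tend to `0`.
  · have key : ∀ n : ℕ, ∃ y ∈ B, ‖f - x * y‖ ≤ (1 / 2) ^ (n + 1) := by
      intro n
      induction n with
      | zero => exact ⟨u, huB, by simpa using hfu⟩
      | succ n ih =>
        obtain ⟨y, hy, hn⟩ := ih
        refine ⟨u * f + y * f - y * (x * u), B.sub_mem (B.add_mem (B.mul_mem huB hfB)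
          (B.mul_mem hy hfB)) (B.mul_mem hy (B.mul_mem hx huB)), ?_⟩
        have : f - x * (u * f + y * f - y * (x * u)) = (f - x * y) * (f - x * u) := by
          simp only [mul_sub, sub_mul, mul_add, hff, hB.prop _ hx _ hy _ hfB,
            hB.prop _ hx _ hy _ (B.mul_mem hx huB), mul_comm f, hB.prop _ hx _ huB _ hfB]
          abel
        rw [this, _root_.pow_succ]
        exact (norm_mul_le' _ _).trans (by gcongr)
    refine Metric.mem_closure_iff.2 fun δ hδ => ?_
    obtain ⟨n, hn⟩ := exists_pow_lt_of_lt_one hδ (show (1 / 2 : ℝ) < 1 by norm_num)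
    obtain ⟨y, hy, h⟩ := key n
    refine ⟨x * y, ⟨y, hy, rfl⟩, ?_⟩
    rw [dist_eq_norm]
    refine (h.trans (pow_le_pow_of_le_one (by norm_num) (by norm_num) n.le_succ)).trans_lt hn
  · have : x - x * f = (x - s) + (s - s * f) + (s - x) * f := by rw [sub_mul]; abel
    rw [this]
    have h3 : ‖(s - x) * f‖ ≤ ε / 4 := by
      calc ‖(s - x) * f‖ ≤ ‖s - x‖ * ‖f‖ := norm_mul_le' _ _
        _ ≤ (ε / 4) * 1 := by
            gcongr
            · rw [norm_sub_rev]; exact hs.le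
            · exact norm_le_one_of_idem hff
        _ = ε / 4 := mul_one _
    calc _ ≤ ‖x - s‖ + ‖s - s * f‖ + ‖(s - x) * f‖ := norm_add₃_le
      _ ≤ ε := by linarith

end Spectral

section Ideal

variable {A : Type*} [JBAlgebra A]

/-! ### Square roots by iteration -/

/-- Polynomial iteration converging to the positive square root of `c`. -/
noncomputable def sqrtIter (c : A) : ℕ → A
  | 0 => 0
  | n + 1 => sqrtIter c n + (1 / 4 : ℝ) • (c - sqrtIter c n * sqrtIter c n)

/-- The scalar version of `sqrtIter`, started from `t²`. -/
noncomputable def realSqrtIter (t : ℝ) : ℕ → ℝ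
  | 0 => 0
  | n + 1 => realSqrtIter t n + 1 / 4 * (t * t - realSqrtIter t n * realSqrtIter t n)

/-- The error obeys `δ' = δ(1 - (t + r)/4) ≤ δ(1 - δ/4)`, which yields decay at rate `4/(n + 1)`. -/
theorem realSqrtIter_bounds {t : ℝ} (h0 : 0 ≤ t) (h2 : t ≤ 2) (n : ℕ) :
    0 ≤ realSqrtIter t n ∧ realSqrtIter t n ≤ t ∧ (t - realSqrtIter t n) * (n + 1) ≤ 4 := by
  induction n with
  | zero => simp only [realSqrtIter]; refine ⟨le_rfl, h0, ?_⟩; norm_num; linarith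
  | succ n ih =>
    obtain ⟨h₁, h₃, h₄⟩ := ih
    simp only [realSqrtIter]
    push_cast
    set r := realSqrtIter t n
    set δ := t - r with hδ
    have hδ0 : 0 ≤ δ := sub_nonneg.2 h₃
    have e : t - (r + 1 / 4 * (t * t - r * r)) = δ * (1 - (t + r) / 4) := by rw [hδ]; ring
    refine ⟨by nlinarith, ?_, ?_⟩
    · rw [← sub_nonneg, e]
      exact mul_nonneg hδ0 (by linarith)
    · have hn : (0 : ℝ) ≤ n := n.cast_nonneg
      rw [e]
      calc δ * (1 - (t + r) / 4) * (n + 1 + 1) ≤ δ * (1 - δ / 4) * (n + 1 + 1) := by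
            gcongr; linarith
        _ = (δ * (n + 1) + δ) * (1 - δ / 4) := by ring
        _ ≤ (4 + δ) * (1 - δ / 4) := by
            gcongr
            linarith
        _ ≤ 4 := by nlinarith [sq_nonneg δ]

theorem IsOrthogonalFamily.sqrtIter_sum {ι : Type*} [Fintype ι] {e : ι → A}
    (he : IsOrthogonalFamily e) (t : ι → ℝ) (n : ℕ) :
    sqrtIter (∑ i, (t i * t i) • e i) n = ∑ i, realSqrtIter (t i) n • e i := by
  induction n with
  | zero => simp [sqrtIter, realSqrtIter]
  | succ n ih =>
    rw [sqrtIter, ih, he.sum_mul_sum, ← Finset.sum_sub_distrib, Finset.smul_sum,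
      ← Finset.sum_add_distrib]
    refine Finset.sum_congr rfl fun i _ => ?_
    rw [realSqrtIter]
    module

theorem continuous_sqrtIter (n : ℕ) : Continuous (fun c : A => sqrtIter c n) := by
  induction n with
  | zero => exact continuous_const
  | succ n ih =>
    simp only [sqrtIter]
    exact ih.add ((continuous_id.sub (ih.mul ih)).const_smul _)

/-- The inequality is closed in `a`, so spectral sums suffice; relaxing the bound `1` to the open
condition `< 2` keeps them dense near `a`. -/
theorem norm_sq_sub_sqrtIter_le [IsAJWAlgebra A] {a : A} (ha : ‖a * a‖ ≤ 1) (n : ℕ) :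
    ‖a * a - sqrtIter ((a * a) * (a * a)) n‖ ≤ 4 / (n + 1) := by
  obtain ⟨B, haB, hB⟩ := exists_maximal_isAssociative a
  have hsq : Continuous fun b : A => b * b := continuous_id.mul continuous_id
  have hclosed : IsClosed {b : A | ‖b * b - sqrtIter ((b * b) * (b * b)) n‖ ≤ 4 / (n + 1)} :=
    isClosed_le (hsq.sub ((continuous_sqrtIter n).comp (hsq.mul hsq))).norm continuous_const
  have hmem : a ∈ closure {s : A | IsSpectralSum B s ∧ ‖s * s‖ < 2} := by
    have hopen : IsOpen {b : A | ‖b * b‖ < 2} := isOpen_lt hsq.norm continuous_const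
    have h1 : a ∈ closure {s : A | IsSpectralSum B s} := by
      refine Metric.mem_closure_iff.2 fun ε hε => ?_
      obtain ⟨s, hs, h⟩ := exists_isSpectralSum_near hB haB hε
      exact ⟨s, hs, by rwa [dist_eq_norm]⟩
    rw [Set.ofPred_and, Set.inter_comm]
    exact hopen.inter_closure ⟨lt_of_le_of_lt ha one_lt_two, h1⟩
  refine closure_minimal ?_ hclosed hmem
  rintro _ ⟨⟨ι, _, e, l, he, -, rfl⟩, hlt⟩
  classical
  -- The norm does not control coefficients of zero projections, so these are reset to `0`.
  let t : ι → ℝ := fun i => if e i = 0 then 0 else l i * l i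
  have ht : (∑ i, l i • e i) * (∑ i, l i • e i) = ∑ i, t i • e i := by
    rw [he.sum_mul_sum]
    refine Finset.sum_congr rfl fun i _ => ?_
    by_cases h : e i = 0 <;> simp [t, h]
  have ht0 : ∀ i, 0 ≤ t i := fun i => by
    simp only [t]; split_ifs
    · exact le_rfl
    · exact mul_self_nonneg _
  have ht2 : ∀ i, t i ≤ 2 := fun i => by
    by_cases h : e i = 0
    · simp [t, h]
    · have := he.abs_le_norm_sum t h
      rw [← ht] at this
      exact (le_abs_self _).trans (this.trans hlt.le)
  change ‖_ - sqrtIter _ n‖ ≤ _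
  rw [ht, he.sum_mul_sum, he.sqrtIter_sum, ← Finset.sum_sub_distrib]
  simp_rw [← sub_smul]
  refine he.norm_sum_le (by positivity) fun i => ?_
  obtain ⟨_, h₂, h₃⟩ := realSqrtIter_bounds (ht0 i) (ht2 i) n
  rw [abs_of_nonneg (sub_nonneg.2 h₂), le_div_iff₀ (by positivity)]
  exact h₃

/-! ### The order on projections -/

theorem mul_mul_mul_of_no_half {p x y : A} (hp : p * p = p) (hx : p * (p * x) = p * x)
    (hy : p * (p * y) = p * y) : p * (p * (x * y)) = p * (x * y) := by
  have h0 : p * (x - p * x) = 0 := by rw [mul_sub, hx, sub_self]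
  have h : x * y = (p * x) * y + (x - p * x) * y := by rw [sub_mul]; abel
  rw [h]
  simp only [mul_add, mul_comm_of_peirce_one hx hp, mul_comm_of_peirce_zero h0 hp, hy]

theorem sqrtIter_no_half {p c : A} (hp : p * p = p) (hc : p * (p * c) = p * c) (n : ℕ) :
    p * (p * sqrtIter c n) = p * sqrtIter c n := by
  induction n with
  | zero => simp [sqrtIter]
  | succ n ih =>
    simp only [sqrtIter, mul_add, mul_sub, mul_smul_comm, hc, ih, mul_mul_mul_of_no_half hp ih ih]

/-- The square of `d = e - p` has no half Peirce component for `p`, hence neither has `d`, a limit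
of polynomials in `d²`. So `e` splits along `p`, and `r = p - pe` is a projection. Since `2r + d` is
again a projection, `‖2r‖ ≤ 1`, which forces `r = 0`. -/
theorem mul_eq_of_le [IsAJWAlgebra A] {p e : A} (hp : p * p = p) (he : e * e = e) (h : Le p e) :
    p * e = p := by
  obtain ⟨a, ha⟩ := h
  have hnorm : ‖a * a‖ ≤ 1 := by
    have := norm_sq_le a p
    rw [← ha, hp, sub_add_cancel] at this
    rw [← ha]
    exact this.trans (norm_le_one_of_idem he)
  have hdd : p * (p * ((a * a) * (a * a))) = p * ((a * a) * (a * a)) := by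
    rw [← ha]
    simp only [mul_sub, sub_mul, he, hp, mul_comm e p]
    linear_combination (norm := module) -peirce_cubic hp e
  have hd : p * (p * (a * a)) = p * (a * a) := by
    have hlim : Filter.Tendsto (fun n => sqrtIter ((a * a) * (a * a)) n) Filter.atTop
        (nhds (a * a)) := by
      rw [tendsto_iff_norm_sub_tendsto_zero]
      have h4 : Filter.Tendsto (fun n : ℕ => (4 : ℝ) / (n + 1)) Filter.atTop (nhds 0) := by
        have := (tendsto_one_div_add_atTop_nhds_zero_nat (𝕜 := ℝ)).const_mul 4
        simpa [div_eq_mul_inv] using this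
      refine squeeze_zero (fun _ => norm_nonneg _) (fun n => ?_) h4
      rw [norm_sub_rev]
      exact norm_sq_sub_sqrtIter_le hnorm n
    have hcl : IsClosed {x : A | p * (p * x) = p * x} :=
      isClosed_eq (continuous_const.mul (continuous_const.mul continuous_id))
        (continuous_const.mul continuous_id)
    exact hcl.mem_of_tendsto hlim (Filter.Eventually.of_forall (sqrtIter_no_half hp hdd))
  have hpe : p * (p * e) = p * e := by
    rw [← ha] at hd
    simp only [mul_sub, hp] at hd
    exact sub_left_injective hd
  have h0 : p * (e - p * e) = 0 := by rw [mul_sub, hpe, sub_self]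
  have h10 : (p * e) * (e - p * e) = 0 := mul_eq_zero_of_peirce hp hpe h0
  have h11 : (p * e) * (p * e) = p * e := by
    have h1 : p * ((p * e) * (p * e)) = (p * e) * (p * e) := by
      rw [mul_comm_of_peirce_one hpe hp, hpe]
    have h2 : p * ((e - p * e) * (e - p * e)) = 0 := by
      rw [mul_comm_of_peirce_zero h0 hp, h0, mul_zero]
    have h3 : e = (p * e) * (p * e) + (e - p * e) * (e - p * e) := by
      rw [mul_sub] at h10
      rw [sub_mul, mul_sub, mul_sub, mul_comm e (p * e), he, h10]
      linear_combination (norm := module) h10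
    conv_rhs => rw [h3, mul_add, h1, h2, add_zero]
  have h1e : (p * e) * e = p * e := by
    rw [mul_sub, h11, sub_eq_zero] at h10
    exact h10
  set r := p - p * e with hr
  have hrr : r * r = r := by
    simp only [hr, mul_sub, sub_mul, hp, hpe, mul_comm (p * e) p, h11]
    abel
  have hproj : (r + (e - p * e)) * (r + (e - p * e)) = r + (e - p * e) := by
    have hre : r * (e - p * e) = 0 := by rw [hr, sub_mul, h0, h10, sub_zero]
    have hee : (e - p * e) * (e - p * e) = e - p * e := by
      simp only [mul_sub, sub_mul, he, h1e, mul_comm e (p * e), h11]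
      abel
    rw [mul_add, add_mul, add_mul, hrr, mul_comm (e - p * e) r, hre, hee]
    abel
  have hb := norm_sq_le (√2 • r) a
  have hbb : (√2 • r) * (√2 • r) = (2 : ℝ) • r := by
    rw [smul_mul_smul_comm, hrr, Real.mul_self_sqrt (by norm_num)]
  have hsum : (2 : ℝ) • r + (e - p) = r + (e - p * e) := by rw [hr]; module
  rw [hbb, ← ha, hsum, norm_smul] at hb
  have h1 := hb.trans (norm_le_one_of_idem hproj)
  have : r = 0 := eq_zero_of_idem_of_norm_lt_one hrr (by norm_num at h1; linarith)
  exact (sub_eq_zero.1 this).symm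

/-! ### Closed ideals -/

/-- For `v = xy` in `xB`, `v² = U_x(y²)` lies in `A₀(p)`. This is a closed condition on `v`, and `f
= f²`. -/
theorem mul_eq_zero_of_mem_closure {B : NonUnitalSubalgebra ℝ A} (hB : IsAssociative B)
    {p x f : A} (hp : p * p = p) (hx : x ∈ B) (hpx : p * x = 0) (hf : f * f = f)
    (hfx : f ∈ closure (Set.image (x * ·) B)) : p * f = 0 := by
  have hcl : IsClosed {v : A | p * (v * v) = 0} :=
    isClosed_eq (continuous_const.mul (continuous_id.mul continuous_id)) continuous_const
  have : f ∈ {v : A | p * (v * v) = 0} := by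
    refine closure_minimal ?_ hcl hfx
    rintro _ ⟨y, hy, rfl⟩
    have hyB : y ∈ B := hy
    have hU : U x (y * y) = (x * y) * (x * y) := by
      have h1 : (x * y) * (x * y) = (x * x) * (y * y) := by
        rw [hB _ hx _ hyB _ (B.mul_mem hx hyB), mul_comm x y, ← hB _ hyB _ hyB _ hx,
          mul_comm (y * y) x, ← hB _ hx _ hx _ (B.mul_mem hyB hyB)]
      rw [U, h1, ← hB _ hx _ hx _ (B.mul_mem hyB hyB)]
      module
    change p * ((x * y) * (x * y)) = 0
    rw [← hU]
    exact mul_U_eq_zero hp hpx _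
  rw [Set.mem_ofPred_eq, hf] at this
  exact this

/-- A projection of an ideal `I` is orthogonal to the elements killed by all `U_b`, `b ∈ I`. -/
theorem mul_eq_zero_of_U_eq_zero {I : Submodule ℝ A} (hI : IsIdeal I) {x p : A} (hp : p * p = p)
    (hpI : p ∈ I) (hx : ∀ b ∈ I, U b x = 0) : p * x = 0 := by
  have hmI : p * x ∈ I := by rw [mul_comm]; exact hI x p hpI
  have h1 := hx p hpI
  have h2 := hx _ hmI
  -- Polarisation: with `m = px ∈ A_{1/2}(p)` and `x - 2m ∈ A₀(p)`, the mixed term of `U_{p+m} x` is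
  -- `4p(m²)`.
  have h3 := hx _ (I.add_mem hpI hmI)
  rw [U, hp] at h1
  have hm : p * (p * x) = (1 / 2 : ℝ) • (p * x) := by
    linear_combination (norm := module) (1 / 2 : ℝ) • h1
  have h0 : p * (x - (2 : ℝ) • (p * x)) = 0 := by
    rw [mul_sub, mul_smul_comm, hm]; module
  have hc := mul_comm_of_peirce_zero h0 hp (p * x)
  rw [hm] at hc
  refine eq_zero_of_peirce_half_of_mul_sq_eq_zero hm ?_
  simp only [U] at h2 h3
  simp only [mul_add, add_mul, hp, mul_comm (p * x) p, hm, smul_mul_assoc] at h2 h3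
  simp only [sub_mul, mul_sub, mul_smul_comm, smul_mul_assoc, mul_comm x (p * x)] at hc
  linear_combination (norm := module) (1 / 4 : ℝ) • (h3 - h2) - (1 / 2 : ℝ) • hc

variable [IsAJWAlgebra A]

/-- A closed ideal has a unit, the supremum of an orthogonal family of its projections. -/
theorem exists_lub_unit_of_isIdeal (I : Submodule ℝ A) (hI : IsIdeal I)
    (hclosed : IsClosed (I : Set A)) :
    ∃ (S : Set A) (g : A), S ⊆ projections A ∧ S ⊆ I ∧ IsProjectionLUB S g ∧
      ∀ x ∈ I, g * x = x := by
  obtain ⟨S, hS⟩ := zorn_subset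
    {S : Set A | S ⊆ projections A ∧ S ⊆ I ∧ S.Pairwise fun p q => p * q = 0}
    (fun c hc hchain => ⟨⋃₀ c, ⟨Set.sUnion_subset fun s hs => (hc hs).1,
      Set.sUnion_subset fun s hs => (hc hs).2.1,
      (Set.pairwise_sUnion hchain.directedOn).2 fun s hs => (hc hs).2.2⟩,
      fun s hs => Set.subset_sUnion_of_mem hs⟩)
  obtain ⟨hSP, hSI, hSo⟩ := hS.prop
  obtain ⟨g, hg⟩ := IsAJWAlgebra.exists_lub S hSP hSo
  have hgg : g * g = g := hg.1
  have hSg : ∀ p ∈ S, g * p = p := fun p hp => by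
    rw [mul_comm]; exact mul_eq_of_le (hSP hp) hgg (hg.2.1 p hp)
  have hzero : ∀ x ∈ I, g * x = 0 → x = 0 := by
    intro x hx hgx
    by_contra hx0
    have hpos : 0 < ‖x‖ := norm_pos_iff.2 hx0
    obtain ⟨B, hxB, hB⟩ := exists_maximal_isAssociative x
    obtain ⟨f, hfB, hff, hfx, hnear⟩ := exists_projection_near hB hxB (half_pos hpos)
    have hgf : g * f = 0 := mul_eq_zero_of_mem_closure hB.prop hgg hxB hgx hff hfx
    have hfI : f ∈ I := by
      refine closure_minimal ?_ hclosed hfx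
      rintro _ ⟨y, -, rfl⟩
      change x * y ∈ I
      rw [mul_comm]
      exact hI y x hx
    have hf0 : f ≠ 0 := by
      rintro rfl
      rw [mul_zero, sub_zero] at hnear
      linarith
    have hins : insert f S ∈
        {S : Set A | S ⊆ projections A ∧ S ⊆ I ∧ S.Pairwise fun p q => p * q = 0} := by
      refine ⟨Set.insert_subset hff hSP, Set.insert_subset hfI hSI, ?_⟩
      refine hSo.insert fun p hp _ => ?_
      have := mul_eq_zero_of_peirce hgg (hSg p hp) hgf
      exact ⟨by rwa [mul_comm], this⟩
    have hfS : f ∈ S := hS.le_of_ge hins (Set.subset_insert f S) (Set.mem_insert f S)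
    exact hf0 (by rw [← hSg f hfS, hgf])
  -- `(1 - t)(1 - 2t)` in multiplication by `g` projects onto `A₀(g)`; below, `t - t²` gives a
  -- multiple of the half component.
  have hzero' : ∀ x ∈ I, x - (3 : ℝ) • (g * x) + (2 : ℝ) • (g * (g * x)) = 0 := by
    intro x hx
    refine hzero _ (I.add_mem (I.sub_mem hx (I.smul_mem _ (hI g x hx)))
      (I.smul_mem _ (hI g _ (hI g x hx)))) ?_
    simp only [mul_add, mul_sub, mul_smul_comm]
    linear_combination (norm := module) peirce_cubic hgg x
  refine ⟨S, g, hSP, hSI, hg, fun x hx => ?_⟩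
  have hm : g * (g * x - g * (g * x)) = (1 / 2 : ℝ) • (g * x - g * (g * x)) := by
    rw [mul_sub]
    linear_combination (norm := module) -(1 / 2 : ℝ) • peirce_cubic hgg x
  have hmI : g * x - g * (g * x) ∈ I := I.sub_mem (hI g x hx) (hI g _ (hI g x hx))
  have hm0 : g * x - g * (g * x) = 0 := by
    refine eq_zero_of_peirce_half_of_mul_sq_eq_self hm ?_
    have h1 := hzero' _ (hI (g * x - g * (g * x)) _ hmI)
    rw [peirce_half_mul_half hgg hm hm] at h1
    linear_combination (norm := module) -h1
  linear_combination (norm := module) -hzero' x hx - (2 : ℝ) • hm0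

variable (A) in
/-- AJW-algebras are unital. -/
theorem exists_unit : ∃ u : A, ∀ x, u * x = x := by
  obtain ⟨-, u, -, -, -, hu⟩ := exists_lub_unit_of_isIdeal (⊤ : Submodule ℝ A)
    (fun _ _ _ => trivial) isClosed_univ
  exact ⟨u, fun x => hu x trivial⟩

/-- What is orthogonal to a family of projections is orthogonal to its supremum. -/
theorem IsProjectionLUB.mul_eq_zero {S : Set A} {g z : A} (hg : IsProjectionLUB S g)
    (hS : S ⊆ projections A) (hz : ∀ p ∈ S, p * z = 0) : g * z = 0 := by
  obtain ⟨u, hu⟩ := exists_unit A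
  have hgg : g * g = g := hg.1
  obtain ⟨B, hzB, hB⟩ := exists_maximal_isAssociative z
  have hcl : IsClosed {x : A | g * x = 0} :=
    isClosed_eq (continuous_const.mul continuous_id) continuous_const
  refine hcl.closure_subset (Metric.mem_closure_iff.2 fun ε hε => ?_)
  obtain ⟨f, hfB, hff, hfz, hnear⟩ := exists_projection_near hB hzB (half_pos hε)
  have huf : (u - f) * (u - f) = u - f := by
    simp only [mul_sub, hu, mul_comm _ u, hff, mul_comm (u - f) f]
    abel
  have hgf : g * f = 0 := by
    -- Each `p ∈ S` is orthogonal to `f`, so `u - f` is an upper bound of `S` in `P(A)`.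
    have hle : Le g (u - f) := by
      refine hg.2.2 _ huf fun p hp => ⟨u - f - p, ?_⟩
      have hpf := mul_eq_zero_of_mem_closure hB.prop (hS hp) hzB (hz p hp) hff hfz
      have hpp : p * p = p := hS hp
      have hup : (u - f) * p = p := by rw [sub_mul, hu, mul_comm f, hpf, sub_zero]
      rw [mul_sub, sub_mul (u - f) p, sub_mul (u - f) p, huf, mul_comm p, hup, hpp]
      abel
    have := mul_eq_of_le hgg huf hle
    rw [mul_sub, mul_comm g u, hu] at this
    simpa using this
  refine ⟨z * f, ?_, ?_⟩
  · have hU : U f z = z * f := by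
      rw [U, ← hB.prop _ hfB _ hfB _ hzB, hff, mul_comm f z]
      module
    change g * (z * f) = 0
    rw [← hU]
    exact mul_U_eq_zero hgg hgf z
  · rw [dist_eq_norm]
    linarith

end Ideal

end JBAlgebra

/-! ### Centrality of `g` and the double annihilator -/

theorem lemma2p4 {A : Type*} [JBAlgebra A] [IsAJWAlgebra A] (I : Submodule ℝ A)
    (hI : JBAlgebra.IsIdeal I) (hclosed : IsClosed (I : Set A)) :
    ∃ g : A, g ∈ JBAlgebra.projections A ∧ g ∈ Set.center A ∧
      JBAlgebra.annPos (JBAlgebra.annPos (I : Set A)) =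
        {x | ∃ a ∈ JBAlgebra.posCone A, x = g * a} := by
  obtain ⟨S, g, hSP, hSI, hg, hunit⟩ := JBAlgebra.exists_lub_unit_of_isIdeal I hI hclosed
  obtain ⟨u, hu⟩ := JBAlgebra.exists_unit A
  have hgg : g * g = g := hg.1
  have hhalf : ∀ x : A, g * (g * x) = g * x := by
    intro x
    have hm : g * (g * x - g * (g * x)) = (1 / 2 : ℝ) • (g * x - g * (g * x)) := by
      rw [mul_sub]
      linear_combination (norm := module) -(1 / 2 : ℝ) • JBAlgebra.peirce_cubic hgg x
    set z := g * x - g * (g * x) with hz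
    -- Since `g` may lie outside `I`, the ideal property is applied to each `p ∈ S` and passed to
    -- the supremum.
    have hgz : g * z = 0 := by
      refine hg.mul_eq_zero hSP fun p hp => ?_
      have h1 : g * (p * z) = p * z := hunit _ (by rw [mul_comm]; exact hI z p (hSI hp))
      rw [JBAlgebra.mul_comm_of_peirce_one (hunit p (hSI hp)) hgg, hm, mul_smul_comm] at h1
      linear_combination (norm := module) (-2 : ℝ) • h1
    rw [hgz] at hm
    have hz0 : z = 0 := by linear_combination (norm := module) (-2 : ℝ) • hm
    exact (sub_eq_zero.1 (hz ▸ hz0)).symm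
  have hcenter : g ∈ Set.center A := JBAlgebra.mem_center_of_mul_mul hhalf hgg
  have hann : JBAlgebra.annPos (I : Set A) = {x | x ∈ JBAlgebra.posCone A ∧ g * x = 0} := by
    ext x
    refine and_congr_right fun _ => ⟨fun h => ?_, fun h b hb => ?_⟩
    · exact hg.mul_eq_zero hSP fun p hp =>
        JBAlgebra.mul_eq_zero_of_U_eq_zero hI (hSP hp) (hSI hp) h
    · exact JBAlgebra.U_eq_zero_of_peirce hgg (hunit b hb) h
  refine ⟨g, hgg, hcenter, ?_⟩
  rw [hann]
  ext x
  constructor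
  · rintro ⟨hx, hU⟩
    refine ⟨x, hx, ?_⟩
    have hug : (u - g) * (u - g) = u - g := by
      rw [mul_sub, sub_mul, sub_mul, hu, hu, mul_comm g u, hu, hgg]; abel
    -- `U_{u-g} x = x - gx`, so this single test element already gives `x = gx`.
    have h := hU (u - g) ⟨⟨u - g, hug.symm⟩, by rw [mul_sub, hgg, mul_comm, hu, sub_self]⟩
    rw [JBAlgebra.U, hug] at h
    simp only [sub_mul, mul_sub, hu, hhalf] at h
    linear_combination (norm := module) h
  · rintro ⟨_, ⟨a, rfl⟩, rfl⟩
    refine ⟨⟨g * a, ?_⟩, fun b hb => ?_⟩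
    · rw [← hcenter.left_assoc, mul_comm a (g * a), ← hcenter.left_assoc, hhalf]
    · exact JBAlgebra.U_eq_zero_of_peirce' hgg hb.2 (hhalf _)
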